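/- Corollary (Connes' embedding conjecture, $\mathbb{F}_\infty$ version). For a discrete group $G$ let $C^*(G)$ be its full group $C^*$-algebra, that is, the completion of the group algebra $\mathbb{C}[G]$ in the norm $\|x\| = \sup_\rho \|\rho(x)\|$, where $\rho$ ranges over all unitary representations of $G$ on Hilbert spaces. For unital $C^*$-algebras $A$ and $B$ let $A \otimes_{\max} B$ be the completion of the algebraic tensor product $A \odot B$ in the norm $\|x\|_{\max} = \sup_\pi \|\pi(x)\|$, where $\pi$ ranges over all unital $*$-representations of $A \odot B$ on Hilbert spaces, and let $A \otimes_{\min} B$ be the completion of $A \odot B$ in the norm $\|x\|_{\min} = \sup_{\pi,\sigma} \|(\pi \otimes \sigma)(x)\|$, where $\pi$ and $\sigma$ range over all unital $*$-representations of $A$ and of $B$ on Hilbert spaces. Write $A \otimes_{\max} B = A \otimes_{\min} B$ if the canonical $*$-homomorphism $A \otimes_{\max} B \to A \otimes_{\min} B$, which extends the identity of $A \odot B$, is an isomorphism. Let $\mathbb{F}$ be the free group on two generators and let $\mathbb{F}_\infty$ be the free group on a countably infinite set of generators. If \[ C^*(\mathbb{F}) \otimes_{\max} C^*(\mathbb{F})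 = C^*(\mathbb{F}) \otimes_{\min} C^*(\mathbb{F}), \] then \[ C^*(\mathbb{F}_\infty) \otimes_{\max} C^*(\mathbb{F}_\infty) = C^*(\mathbb{F}_\infty) \otimes_{\min} C^*(\mathbb{F}_\infty). \] -/

import Mathlib

open scoped TensorProduct

universe u

noncomputable section

/-! ## Representations of unital complex `*`-algebras on Hilbert spaces -/

/-- A unital `*`-representation of the unital complex `*`-algebra `R` by bounded operators on a
complex Hilbert space `Space`. -/
structure StarRep (R : Type u) [Ring R] [StarRing R] [Algebra ℂ R] : Type (u + 1) where
  Space : Type u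
  [instNormed : NormedAddCommGroup Space]
  [instInner : InnerProductSpace ℂ Space]
  [instComplete : CompleteSpace Space]
  hom : R →⋆ₐ[ℂ] (Space →L[ℂ] Space)

attribute [instance] StarRep.instNormed StarRep.instInner StarRep.instComplete

/-! ## `C*`-seminorms and the `C*`-algebras obtained by separation and completion -/

/-- A `C*`-seminorm on a unital complex `*`-algebra. -/
structure CStarSeminorm (R : Type u) [Ring R] [StarRing R] [Algebra ℂ R]
    extends Seminorm ℂ R where
  mul_le' : ∀ x y : R, toFun (x * y) ≤ toFun x * toFun y
  star_mul_self' : ∀ x : R, toFun (star x * x) = toFun x * toFun x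

namespace CStarSeminorm

section Basic

variable {R : Type u} [Ring R] [StarRing R] [Algebra ℂ R]

instance : CoeFun (CStarSeminorm R) (fun _ => R → ℝ) := ⟨fun p => p.toSeminorm⟩

theorem mul_le (p : CStarSeminorm R) (x y : R) : p (x * y) ≤ p x * p y := p.mul_le' x y

theorem star_mul_self (p : CStarSeminorm R) (x : R) : p (star x * x) = p x * p x :=
  p.star_mul_self' x

theorem nonneg (p : CStarSeminorm R) (x : R) : 0 ≤ p x := apply_nonneg p.toSeminorm x

theorem le_star (p : CStarSeminorm R) (x : R) : p x ≤ p (star x) := by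
  by_contra! h
  have h1 := p.star_mul_self x
  have h2 := p.mul_le (star x) x
  have h3 := p.nonneg (star x)
  nlinarith

theorem apply_star (p : CStarSeminorm R) (x : R) : p (star x) = p x :=
  le_antisymm (by simpa using p.le_star (star x)) (p.le_star x)

/-- The seminorm `x ↦ sup_i ‖π_i x‖` given by a family of `*`-representations `π_i` that is
pointwise bounded. -/
def ofFamily {ι : Type*} (π : ι → StarRep R)
    (hπ : ∀ x, BddAbove (Set.range fun i => ‖(π i).hom x‖)) : CStarSeminorm R where
  toFun x := ⨆ i, ‖(π i).hom x‖
  map_zero' := by simp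
  add_le' x y := by
    refine Real.iSup_le (fun i => ?_)
      (add_nonneg (Real.iSup_nonneg fun i => norm_nonneg _)
        (Real.iSup_nonneg fun i => norm_nonneg _))
    rw [_root_.map_add]
    exact (norm_add_le _ _).trans (add_le_add (le_ciSup (hπ x) i) (le_ciSup (hπ y) i))
  neg' x := by simp
  smul' c x := by
    simp only [map_smul, norm_smul]
    exact (Real.mul_iSup_of_nonneg (norm_nonneg c) _).symm
  mul_le' x y := by
    refine Real.iSup_le (fun i => ?_)
      (mul_nonneg (Real.iSup_nonneg fun i => norm_nonneg _)
        (Real.iSup_nonneg fun i => norm_nonneg _))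
    rw [map_mul]
    exact (norm_mul_le _ _).trans (mul_le_mul (le_ciSup (hπ x) i) (le_ciSup (hπ y) i)
      (norm_nonneg _) (Real.iSup_nonneg fun i => norm_nonneg _))
  star_mul_self' x := by
    have h0 : 0 ≤ ⨆ i, ‖(π i).hom x‖ := Real.iSup_nonneg fun i => norm_nonneg _
    have key : ∀ i, ‖(π i).hom (star x * x)‖ = ‖(π i).hom x‖ * ‖(π i).hom x‖ := fun i => by
      rw [map_mul, map_star, CStarRing.norm_star_mul_self]
    refine le_antisymm (Real.iSup_le (fun i => ?_) (mul_nonneg h0 h0)) ?_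
    · rw [key]
      exact mul_self_le_mul_self (norm_nonneg _) (le_ciSup (hπ x) i)
    · have h1 : 0 ≤ ⨆ i, ‖(π i).hom (star x * x)‖ := Real.iSup_nonneg fun i => norm_nonneg _
      have h2 : (⨆ i, ‖(π i).hom x‖) ≤ Real.sqrt (⨆ i, ‖(π i).hom (star x * x)‖) := by
        refine Real.iSup_le (fun i => Real.le_sqrt_of_sq_le ?_) (Real.sqrt_nonneg _)
        rw [sq, ← key]
        exact le_ciSup (hπ (star x * x)) i
      calc _ ≤ _ := mul_self_le_mul_self h0 h2
        _ = _ := Real.mul_self_sqrt h1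

theorem ofFamily_apply {ι : Type*} (π : ι → StarRep R)
    (hπ : ∀ x, BddAbove (Set.range fun i => ‖(π i).hom x‖)) (x : R) :
    ofFamily π hπ x = ⨆ i, ‖(π i).hom x‖ := rfl

end Basic

section Completion

variable {R : Type u} [Ring R] [StarRing R] [Algebra ℂ R] [StarModule ℂ R]

set_option linter.unusedSectionVars false

/-- The `*`-algebra `R`, regarded as a seminormed algebra through the `C*`-seminorm `p`. -/
def Pre (_p : CStarSeminorm R) : Type u := R

variable (p : CStarSeminorm R)

instance : Ring p.Pre := inferInstanceAs (Ring R)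
instance : StarRing p.Pre := inferInstanceAs (StarRing R)
instance : Algebra ℂ p.Pre := inferInstanceAs (Algebra ℂ R)
instance : StarModule ℂ p.Pre := inferInstanceAs (StarModule ℂ R)

instance : SeminormedRing p.Pre where
  __ := (inferInstance : Ring p.Pre)
  __ := AddGroupSeminorm.toSeminormedAddCommGroup (E := R) p.toAddGroupSeminorm
  norm_mul_le := p.mul_le

theorem norm_pre (x : p.Pre) : ‖x‖ = p (show R from x) := rfl

instance : NormedSpace ℂ p.Pre where
  norm_smul_le c x := (map_smul_eq_mul p.toSeminorm c (show R from x)).le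

instance : NormedStarGroup p.Pre where
  norm_star_le x := (p.apply_star (show R from x)).le

/-- The Hausdorff completion of the `*`-algebra `R` with respect to the `C*`-seminorm `p`; it is a
unital `C*`-algebra. (If `p` is a norm, this is the completion of `R`.) -/
def Completion : Type u := UniformSpace.Completion p.Pre

namespace Completion

/-- The continuous extension of the involution to the completion. -/
instance instStar : Star (UniformSpace.Completion p.Pre) := ⟨UniformSpace.Completion.map star⟩

theorem coe_star (a : p.Pre) :
    star (a : UniformSpace.Completion p.Pre) = ((star a : p.Pre) : UniformSpace.Completion p.Pre) :=
  UniformSpace.Completion.map_coe star_isometry.uniformContinuous a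

theorem continuous_star_completion :
    Continuous (star : UniformSpace.Completion p.Pre → UniformSpace.Completion p.Pre) :=
  UniformSpace.Completion.continuous_map

instance instStarRing : StarRing (UniformSpace.Completion p.Pre) where
  star_involutive x := by
    induction x using UniformSpace.Completion.induction_on with
    | hp =>
      exact isClosed_eq ((continuous_star_completion p).comp (continuous_star_completion p))
        continuous_id
    | ih a => rw [coe_star, coe_star, star_star]
  star_mul x y := by
    induction x, y using UniformSpace.Completion.induction_on₂ with
    | hp =>
      exact isClosed_eq ((continuous_star_completion p).comp continuous_mul)
        (((continuous_star_completion p).comp continuous_snd).mul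
          ((continuous_star_completion p).comp continuous_fst))
    | ih a b =>
      rw [← UniformSpace.Completion.coe_mul, coe_star, coe_star, coe_star, star_mul,
        UniformSpace.Completion.coe_mul]
  star_add x y := by
    induction x, y using UniformSpace.Completion.induction_on₂ with
    | hp =>
      exact isClosed_eq ((continuous_star_completion p).comp continuous_add)
        (((continuous_star_completion p).comp continuous_fst).add
          ((continuous_star_completion p).comp continuous_snd))
    | ih a b =>
      rw [← UniformSpace.Completion.coe_add, coe_star, coe_star, coe_star, star_add,
        UniformSpace.Completion.coe_add]

instance instStarModule : StarModule ℂ (UniformSpace.Completion p.Pre) where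
  star_smul c x := by
    induction x using UniformSpace.Completion.induction_on with
    | hp =>
      exact isClosed_eq ((continuous_star_completion p).comp (continuous_const_smul c))
        ((continuous_star_completion p).const_smul (star c))
    | ih a =>
      rw [← UniformSpace.Completion.coe_smul, coe_star, coe_star, star_smul,
        UniformSpace.Completion.coe_smul]

instance instCStarRing : CStarRing (UniformSpace.Completion p.Pre) where
  norm_mul_self_le x := by
    induction x using UniformSpace.Completion.induction_on with
    | hp =>
      exact isClosed_le (continuous_norm.mul continuous_norm)
        (continuous_norm.comp ((continuous_star_completion p).mul continuous_id))
    | ih a =>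
      rw [coe_star, ← UniformSpace.Completion.coe_mul, UniformSpace.Completion.norm_coe,
        UniformSpace.Completion.norm_coe]
      exact (p.star_mul_self (show R from a)).ge

instance instCStarAlgebra : CStarAlgebra p.Completion where
  __ := (inferInstance : NormedRing (UniformSpace.Completion p.Pre))
  __ := (inferInstance : Algebra ℂ (UniformSpace.Completion p.Pre))
  __ := (inferInstance : CompleteSpace (UniformSpace.Completion p.Pre))
  __ := instStarRing p
  __ := instStarModule p
  __ := instCStarRing p
  norm_smul_le := (inferInstance : NormedSpace ℂ (UniformSpace.Completion p.Pre)).norm_smul_le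

end Completion

/-- The canonical `*`-homomorphism from `R` to its completion. -/
def of : R →⋆ₐ[ℂ] p.Completion where
  toFun x := ((show p.Pre from x : p.Pre) : UniformSpace.Completion p.Pre)
  map_one' := rfl
  map_mul' x y := UniformSpace.Completion.coe_mul (α := p.Pre) x y
  map_zero' := rfl
  map_add' x y := UniformSpace.Completion.coe_add (α := p.Pre) x y
  commutes' _ := rfl
  map_star' x := (Completion.coe_star p (show p.Pre from x)).symm

theorem norm_of (x : R) : ‖p.of x‖ = p x :=
  UniformSpace.Completion.norm_coe (show p.Pre from x)

theorem denseRange_of : DenseRange p.of :=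
  UniformSpace.Completion.denseRange_coe (α := p.Pre)

variable {p}

/-- A `*`-homomorphism `f` from `R` to a `C*`-algebra with `‖f x‖ ≤ p x` extends to the
completion of `R`. -/
def lift {B : Type u} [CStarAlgebra B] (f : R →⋆ₐ[ℂ] B) (hf : ∀ x, ‖f x‖ ≤ p x) :
    p.Completion →⋆ₐ[ℂ] B :=
  let f' : p.Pre →+* B := (f : R →+* B)
  have hc : Continuous f' :=
    AddMonoidHomClass.continuous_of_bound f' 1 fun x => by
      rw [one_mul]
      exact hf x
  let g : UniformSpace.Completion p.Pre →+* B := UniformSpace.Completion.extensionHom f' hc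
  have hg : ∀ a : p.Pre, g a = f (show R from a) :=
    fun a => UniformSpace.Completion.extensionHom_coe f' hc a
  have hgc : Continuous g := UniformSpace.Completion.continuous_extension
  { toFun := g
    map_one' := map_one g
    map_mul' := map_mul g
    map_zero' := map_zero g
    map_add' := map_add g
    commutes' := fun c => (hg (algebraMap ℂ R c)).trans (AlgHomClass.commutes f c)
    map_star' := fun x => by
      induction x using UniformSpace.Completion.induction_on with
      | hp =>
        exact isClosed_eq (hgc.comp (Completion.continuous_star_completion p))
          (continuous_star.comp hgc)
      | ih a =>
        change g (star (a : UniformSpace.Completion p.Pre)) =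
          star (g (a : UniformSpace.Completion p.Pre))
        rw [Completion.coe_star, hg, hg, ← map_star f]
        rfl }

theorem lift_of {B : Type u} [CStarAlgebra B] (f : R →⋆ₐ[ℂ] B) (hf : ∀ x, ‖f x‖ ≤ p x) (x : R) :
    lift f hf (p.of x) = f x :=
  UniformSpace.Completion.extensionHom_coe (α := p.Pre) (f : R →+* B)
    (AddMonoidHomClass.continuous_of_bound (E := p.Pre) (f : R →+* B) 1 fun x => by
      rw [one_mul]
      exact hf x) x

end Completion

end CStarSeminorm

/-! ## The complex group algebra and the full group `C*`-algebra -/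

section GroupAlgebra

variable {G : Type u} [Group G]

/-- The involution of the group algebra, `(∑ a_g g)^* = ∑ conj(a_g) g⁻¹`. -/
instance MonoidAlgebra.instStarComplex : Star (MonoidAlgebra ℂ G) where
  star x := MonoidAlgebra.mapDomain (fun g => g⁻¹) (MonoidAlgebra.map (starRingEnd ℂ) x)

theorem MonoidAlgebra.star_single_complex (g : G) (a : ℂ) :
    star (MonoidAlgebra.single g a) = MonoidAlgebra.single g⁻¹ (star a) := by
  change MonoidAlgebra.mapDomain _ (MonoidAlgebra.map _ _) = _
  simp

theorem MonoidAlgebra.star_add_complex (x y : MonoidAlgebra ℂ G) :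
    star (x + y) = star x + star y := by
  change MonoidAlgebra.mapDomain _ (MonoidAlgebra.map _ _) =
    MonoidAlgebra.mapDomain _ (MonoidAlgebra.map _ _) +
      MonoidAlgebra.mapDomain _ (MonoidAlgebra.map _ _)
  rw [MonoidAlgebra.map_add, MonoidAlgebra.mapDomain_add]

theorem MonoidAlgebra.star_zero_complex : star (0 : MonoidAlgebra ℂ G) = 0 := by
  change MonoidAlgebra.mapDomain _ (MonoidAlgebra.map _ _) = _
  simp

instance MonoidAlgebra.instStarRingComplex : StarRing (MonoidAlgebra ℂ G) where
  star_involutive x := by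
    induction x using MonoidAlgebra.induction_linear with
    | zero => rw [MonoidAlgebra.star_zero_complex, MonoidAlgebra.star_zero_complex]
    | add x y hx hy => rw [MonoidAlgebra.star_add_complex, MonoidAlgebra.star_add_complex, hx, hy]
    | single g a => simp [MonoidAlgebra.star_single_complex]
  star_mul x y := by
    induction x using MonoidAlgebra.induction_linear with
    | zero => simp [MonoidAlgebra.star_zero_complex]
    | add x x' hx hx' => rw [add_mul, MonoidAlgebra.star_add_complex, hx, hx',
        MonoidAlgebra.star_add_complex, mul_add]
    | single g a =>
      induction y using MonoidAlgebra.induction_linear with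
      | zero => simp [MonoidAlgebra.star_zero_complex]
      | add y y' hy hy' => rw [mul_add, MonoidAlgebra.star_add_complex, hy, hy',
          MonoidAlgebra.star_add_complex, add_mul]
      | single h b =>
        simp [MonoidAlgebra.star_single_complex, MonoidAlgebra.single_mul_single, mul_comm]
  star_add := MonoidAlgebra.star_add_complex

instance MonoidAlgebra.instStarModuleComplex : StarModule ℂ (MonoidAlgebra ℂ G) where
  star_smul c x := by
    induction x using MonoidAlgebra.induction_linear with
    | zero => simp
    | add x y hx hy => rw [smul_add, star_add, hx, hy, star_add, smul_add]
    | single g a => simp [MonoidAlgebra.star_single_complex]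

end GroupAlgebra

/-- A unitary representation of the discrete group `G` on a complex Hilbert space. -/
structure UnitaryRep (G : Type u) [Group G] : Type (u + 1) where
  Space : Type u
  [instNormed : NormedAddCommGroup Space]
  [instInner : InnerProductSpace ℂ Space]
  [instComplete : CompleteSpace Space]
  hom : G →* unitary (Space →L[ℂ] Space)

attribute [instance] UnitaryRep.instNormed UnitaryRep.instInner UnitaryRep.instComplete

namespace UnitaryRep

variable {G : Type u} [Group G] (ρ : UnitaryRep G)

/-- The linear extension `ρ(∑ a_g g) = ∑ a_g ρ(g)` of a unitary representation of `G` to the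
group algebra. -/
def toStarRep : StarRep (MonoidAlgebra ℂ G) where
  Space := ρ.Space
  hom :=
    { MonoidAlgebra.lift ℂ (ρ.Space →L[ℂ] ρ.Space) G
        ((unitary (ρ.Space →L[ℂ] ρ.Space)).subtype.comp ρ.hom) with
      map_star' := fun x => by
        change MonoidAlgebra.lift ℂ (ρ.Space →L[ℂ] ρ.Space) G _ (star x) =
          star (MonoidAlgebra.lift ℂ (ρ.Space →L[ℂ] ρ.Space) G _ x)
        induction x using MonoidAlgebra.induction_linear with
        | zero => simp
        | add x y hx hy => rw [star_add, map_add, hx, hy, map_add, star_add]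
        | single g a => simp [MonoidAlgebra.star_single_complex, ← Unitary.star_eq_inv] }

theorem toStarRep_single (g : G) (a : ℂ) :
    ρ.toStarRep.hom (MonoidAlgebra.single g a) = a • (ρ.hom g : ρ.Space →L[ℂ] ρ.Space) :=
  MonoidAlgebra.lift_single _ _ _

theorem bddAbove (x : MonoidAlgebra ℂ G) :
    BddAbove (Set.range fun ρ : UnitaryRep G => ‖ρ.toStarRep.hom x‖) := by
  induction x using MonoidAlgebra.induction_linear with
  | zero => exact ⟨0, by rintro _ ⟨ρ, rfl⟩; simp⟩
  | add x y hx hy =>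
    obtain ⟨C, hC⟩ := hx
    obtain ⟨D, hD⟩ := hy
    refine ⟨C + D, ?_⟩
    rintro _ ⟨ρ, rfl⟩
    simp only [map_add]
    exact (norm_add_le _ _).trans (add_le_add (hC ⟨ρ, rfl⟩) (hD ⟨ρ, rfl⟩))
  | single g a =>
    refine ⟨‖a‖, ?_⟩
    rintro _ ⟨ρ, rfl⟩
    change ‖ρ.toStarRep.hom (MonoidAlgebra.single g a)‖ ≤ ‖a‖
    rw [toStarRep_single]
    change ‖a • (ρ.hom g : ρ.Space →L[ℂ] ρ.Space)‖ ≤ ‖a‖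
    rw [norm_smul]
    refine mul_le_of_le_one_right (norm_nonneg a) ?_
    refine ContinuousLinearMap.opNorm_le_bound _ zero_le_one fun v => ?_
    rw [one_mul, Unitary.norm_map]

end UnitaryRep

/-- The norm of the full group `C*`-algebra on `ℂ[G]`: the supremum of `‖ρ(x)‖` over all unitary
representations `ρ` of `G`. -/
def fullGroupSeminorm (G : Type u) [Group G] : CStarSeminorm (MonoidAlgebra ℂ G) :=
  CStarSeminorm.ofFamily (fun ρ : UnitaryRep G => ρ.toStarRep) UnitaryRep.bddAbove

/-- The full group `C*`-algebra `C*(G)` of a discrete group `G`. -/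
abbrev FullGroupCStar (G : Type u) [Group G] : Type u := (fullGroupSeminorm G).Completion

/-! ## Maximal and minimal tensor products of unital `C*`-algebras -/

section HilbertTensor

variable (H K : Type u) [NormedAddCommGroup H] [InnerProductSpace ℂ H]
  [NormedAddCommGroup K] [InnerProductSpace ℂ K]

/-- The Hilbert space tensor product of `H` and `K`. -/
abbrev HilbertTensor : Type u := UniformSpace.Completion (H ⊗[ℂ] K)

variable {H K}

/-- The tensor product of two bounded operators, acting on the Hilbert space tensor product. -/
def opTensor (S : H →L[ℂ] H) (T : K →L[ℂ] K) : HilbertTensor H K →L[ℂ] HilbertTensor H K :=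
  (TensorProduct.mapL S T).completion

theorem opTensor_coe (S : H →L[ℂ] H) (T : K →L[ℂ] K) (z : H ⊗[ℂ] K) :
    opTensor S T (z : HilbertTensor H K) =
      ((TensorProduct.mapL S T z : H ⊗[ℂ] K) : HilbertTensor H K) :=
  ContinuousLinearMap.completion_apply_coe _ _

theorem HilbertTensor.clm_ext {f g : HilbertTensor H K →L[ℂ] HilbertTensor H K}
    (h : ∀ z : H ⊗[ℂ] K, f (z : HilbertTensor H K) = g (z : HilbertTensor H K)) : f = g := by
  ext z
  induction z using UniformSpace.Completion.induction_on with
  | hp => exact isClosed_eq f.continuous g.continuous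
  | ih z => exact h z

theorem opTensor_mul (S S' : H →L[ℂ] H) (T T' : K →L[ℂ] K) :
    opTensor (S * S') (T * T') = opTensor S T * opTensor S' T' :=
  HilbertTensor.clm_ext fun z => by
    rw [mul_apply_eq_comp, opTensor_coe, opTensor_coe, opTensor_coe,
      TensorProduct.mapL_mul, mul_apply_eq_comp]

theorem opTensor_one : opTensor (1 : H →L[ℂ] H) (1 : K →L[ℂ] K) = 1 :=
  HilbertTensor.clm_ext fun z => by
    rw [opTensor_coe]
    exact congrArg _ (DFunLike.congr_fun (TensorProduct.mapL_id_id (𝕜 := ℂ) (E := H) (G := K)) z)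

theorem opTensor_add_left (S S' : H →L[ℂ] H) (T : K →L[ℂ] K) :
    opTensor (S + S') T = opTensor S T + opTensor S' T :=
  HilbertTensor.clm_ext fun z => by
    rw [add_apply, opTensor_coe, opTensor_coe, opTensor_coe,
      TensorProduct.mapL_add_left, add_apply, UniformSpace.Completion.coe_add]

theorem opTensor_add_right (S : H →L[ℂ] H) (T T' : K →L[ℂ] K) :
    opTensor S (T + T') = opTensor S T + opTensor S T' :=
  HilbertTensor.clm_ext fun z => by
    rw [add_apply, opTensor_coe, opTensor_coe, opTensor_coe,
      TensorProduct.mapL_add_right, add_apply, UniformSpace.Completion.coe_add]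

theorem opTensor_smul_left (c : ℂ) (S : H →L[ℂ] H) (T : K →L[ℂ] K) :
    opTensor (c • S) T = c • opTensor S T :=
  HilbertTensor.clm_ext fun z => by
    rw [smul_apply, opTensor_coe, opTensor_coe,
      TensorProduct.mapL_smul_left, smul_apply,
      UniformSpace.Completion.coe_smul]

theorem opTensor_smul_right (c : ℂ) (S : H →L[ℂ] H) (T : K →L[ℂ] K) :
    opTensor S (c • T) = c • opTensor S T :=
  HilbertTensor.clm_ext fun z => by
    rw [smul_apply, opTensor_coe, opTensor_coe,
      TensorProduct.mapL_smul_right, smul_apply,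
      UniformSpace.Completion.coe_smul]

theorem opTensor_star [CompleteSpace H] [CompleteSpace K] (S : H →L[ℂ] H) (T : K →L[ℂ] K) :
    opTensor (star S) (star T) = star (opTensor S T) := by
  rw [ContinuousLinearMap.star_eq_adjoint (opTensor S T), ContinuousLinearMap.eq_adjoint_iff]
  intro x y
  induction x, y using UniformSpace.Completion.induction_on₂ with
  | hp => apply isClosed_eq <;> fun_prop
  | ih x y =>
    rw [opTensor_coe, opTensor_coe, UniformSpace.Completion.inner_coe,
      UniformSpace.Completion.inner_coe]
    induction x using TensorProduct.induction_on with
    | zero => simp only [map_zero, inner_zero_left]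
    | add x x' hx hx' => rw [map_add, inner_add_left, inner_add_left, hx, hx']
    | tmul a b =>
      induction y using TensorProduct.induction_on with
      | zero => simp only [map_zero, inner_zero_right]
      | add y y' hy hy' => rw [map_add, inner_add_right, inner_add_right, hy, hy']
      | tmul c d =>
        rw [TensorProduct.mapL_tmul, TensorProduct.mapL_tmul, TensorProduct.inner_tmul,
          TensorProduct.inner_tmul, ContinuousLinearMap.star_eq_adjoint,
          ContinuousLinearMap.star_eq_adjoint, ContinuousLinearMap.adjoint_inner_left,
          ContinuousLinearMap.adjoint_inner_left]

end HilbertTensor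

section TensorProducts

variable {A B : Type u} [CStarAlgebra A] [CStarAlgebra B]

/-- The linear map `A ⊗ B → B(H ⊗ K)` with `a ⊗ b ↦ π(a) ⊗ σ(b)`. -/
def StarRep.tensorLinear (π : StarRep A) (σ : StarRep B) : A ⊗[ℂ] B →ₗ[ℂ]
    (HilbertTensor π.Space σ.Space →L[ℂ] HilbertTensor π.Space σ.Space) :=
  TensorProduct.lift (LinearMap.mk₂ ℂ (fun a b => opTensor (π.hom a) (σ.hom b))
    (fun a a' b => by rw [map_add, opTensor_add_left])
    (fun c a b => by rw [map_smul, opTensor_smul_left])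
    (fun a b b' => by rw [map_add, opTensor_add_right])
    (fun c a b => by rw [map_smul, opTensor_smul_right]))

theorem StarRep.tensorLinear_tmul (π : StarRep A) (σ : StarRep B) (a : A) (b : B) :
    π.tensorLinear σ (a ⊗ₜ b) = opTensor (π.hom a) (σ.hom b) := rfl

theorem StarRep.tensorLinear_star (π : StarRep A) (σ : StarRep B) (x : A ⊗[ℂ] B) :
    π.tensorLinear σ (star x) = star (π.tensorLinear σ x) := by
  induction x using TensorProduct.induction_on with
  | zero => rw [star_zero, LinearMap.map_zero]; exact (star_zero
      (HilbertTensor π.Space σ.Space →L[ℂ] HilbertTensor π.Space σ.Space)).symm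
  | add x y hx hy =>
    rw [star_add, LinearMap.map_add, hx, hy, LinearMap.map_add]
    exact (star_add (R := HilbertTensor π.Space σ.Space →L[ℂ] HilbertTensor π.Space σ.Space)
      _ _).symm
  | tmul a b =>
    rw [TensorProduct.star_tmul, tensorLinear_tmul, tensorLinear_tmul, map_star, map_star,
      opTensor_star]

/-- The tensor product representation `π ⊗ σ` of the algebraic tensor product `A ⊗ B` on the
Hilbert space tensor product, `(π ⊗ σ)(a ⊗ b) = π(a) ⊗ σ(b)`. -/
def StarRep.tensor (π : StarRep A) (σ : StarRep B) : StarRep (A ⊗[ℂ] B) where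
  Space := HilbertTensor π.Space σ.Space
  hom :=
    { Algebra.TensorProduct.algHomOfLinearMapTensorProduct (π.tensorLinear σ)
        (fun a a' b b' => by
          rw [tensorLinear_tmul, tensorLinear_tmul, tensorLinear_tmul, map_mul, map_mul,
            opTensor_mul])
        (by rw [tensorLinear_tmul, map_one, map_one, opTensor_one]) with
      map_star' := π.tensorLinear_star σ }

theorem StarRep.tensor_tmul (π : StarRep A) (σ : StarRep B) (a : A) (b : B) :
    (π.tensor σ).hom (a ⊗ₜ b) = opTensor (π.hom a) (σ.hom b) := rfl

theorem StarRep.bddAbove_tensor (x : A ⊗[ℂ] B) :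
    BddAbove (Set.range fun π : StarRep (A ⊗[ℂ] B) => ‖π.hom x‖) := by
  induction x using TensorProduct.induction_on with
  | zero => exact ⟨0, by rintro _ ⟨ρ, rfl⟩; simp⟩
  | add x y hx hy =>
    obtain ⟨C, hC⟩ := hx
    obtain ⟨D, hD⟩ := hy
    refine ⟨C + D, ?_⟩
    rintro _ ⟨ρ, rfl⟩
    simp only [map_add]
    exact (norm_add_le _ _).trans (add_le_add (hC ⟨ρ, rfl⟩) (hD ⟨ρ, rfl⟩))
  | tmul a b =>
    refine ⟨‖a‖ * ‖b‖, ?_⟩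
    rintro _ ⟨π, rfl⟩
    let f : A →⋆ₐ[ℂ] (π.Space →L[ℂ] π.Space) :=
      { π.hom.toAlgHom.comp Algebra.TensorProduct.includeLeft with
        map_star' := fun a => by
          change π.hom (star a ⊗ₜ[ℂ] 1) = star (π.hom (a ⊗ₜ[ℂ] 1))
          rw [← map_star, TensorProduct.star_tmul, star_one] }
    let g : B →⋆ₐ[ℂ] (π.Space →L[ℂ] π.Space) :=
      { π.hom.toAlgHom.comp Algebra.TensorProduct.includeRight with
        map_star' := fun b => by
          change π.hom (1 ⊗ₜ[ℂ] star b) = star (π.hom (1 ⊗ₜ[ℂ] b))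
          rw [← map_star, TensorProduct.star_tmul, star_one] }
    have h : π.hom (a ⊗ₜ b) = f a * g b := by
      change _ = π.hom (a ⊗ₜ[ℂ] 1) * π.hom (1 ⊗ₜ[ℂ] b)
      rw [← map_mul, Algebra.TensorProduct.tmul_mul_tmul, mul_one, one_mul]
    change ‖π.hom (a ⊗ₜ b)‖ ≤ _
    rw [h]
    exact (norm_mul_le _ _).trans (mul_le_mul (NonUnitalStarAlgHom.norm_apply_le f a)
      (NonUnitalStarAlgHom.norm_apply_le g b) (norm_nonneg _) (norm_nonneg _))

variable (A B)

/-- The maximal `C*`-norm on `A ⊗ B`: the supremum of `‖π(x)‖` over all `*`-representations `π` of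
the algebraic tensor product. -/
def maxTensorSeminorm : CStarSeminorm (A ⊗[ℂ] B) :=
  CStarSeminorm.ofFamily (fun π : StarRep (A ⊗[ℂ] B) => π) StarRep.bddAbove_tensor

/-- The minimal (spatial) `C*`-norm on `A ⊗ B`: the supremum of `‖(π ⊗ σ)(x)‖` over all
`*`-representations `π` of `A` and `σ` of `B`. -/
def minTensorSeminorm : CStarSeminorm (A ⊗[ℂ] B) :=
  CStarSeminorm.ofFamily (fun πσ : StarRep A × StarRep B => πσ.1.tensor πσ.2) fun x =>
    (StarRep.bddAbove_tensor x).mono (by rintro _ ⟨πσ, rfl⟩; exact ⟨πσ.1.tensor πσ.2, rfl⟩)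

/-- The maximal tensor product `A ⊗_max B`. -/
abbrev MaxTensor : Type u := (maxTensorSeminorm A B).Completion

/-- The minimal tensor product `A ⊗_min B`. -/
abbrev MinTensor : Type u := (minTensorSeminorm A B).Completion

theorem minTensorSeminorm_le (x : A ⊗[ℂ] B) : minTensorSeminorm A B x ≤ maxTensorSeminorm A B x :=
  Real.iSup_le (fun πσ => le_ciSup (StarRep.bddAbove_tensor x) (πσ.1.tensor πσ.2))
    ((maxTensorSeminorm A B).nonneg x)

/-- The canonical `*`-homomorphism `A ⊗_max B → A ⊗_min B`, the extension by continuity of the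
identity map of the algebraic tensor product `A ⊗ B`. -/
def maxToMin : MaxTensor A B →⋆ₐ[ℂ] MinTensor A B :=
  CStarSeminorm.lift (minTensorSeminorm A B).of fun x => by
    rw [CStarSeminorm.norm_of]
    exact minTensorSeminorm_le A B x

theorem maxToMin_of (x : A ⊗[ℂ] B) :
    maxToMin A B ((maxTensorSeminorm A B).of x) = (minTensorSeminorm A B).of x :=
  CStarSeminorm.lift_of _ _ x

/-- `A ⊗_max B = A ⊗_min B`: the canonical `*`-homomorphism between the two completions of the
algebraic tensor product is an isomorphism. -/
def MaxTensorEqMinTensor : Prop := Function.Bijective (maxToMin A B)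

end TensorProducts

end

/-! The maximal and minimal tensor products coincide exactly when the two norms agree on the
algebraic tensor product (`maxTensorEqMinTensor_iff`), so the task is to bound the maximal norm by
the minimal one.

The group homomorphism sending the `n`-th generator of `F_∞` to `a⁻ⁿ b aⁿ` induces `f : C*(F_∞) →
C*(F_2)`. The minimal norm never grows under `f ⊗ f`, since representations pull back
(`minTensorSeminorm_map_le`). If moreover the maximal norm does not shrink under `f ⊗ f`, then max ≤
max of the image = min of the image ≤ min (`MaxTensorEqMinTensor.of_map`). Injectivity of the group
homomorphism is never invoked.

The maximal norm does not shrink because commuting representations of two copies of `C*(F_∞)` on `K`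
dilate to commuting representations of two copies of `C*(F_2)` on `ℓ²(ℤ × ℤ, K)`. In the first copy
`a` shifts the first coordinate and `b` is diagonal, acting on the block `(m, k)` by the image of
generator `m` (for `m ≥ 0`); the second copy uses the second coordinate in the same way. On the
block at the origin, `a⁻ⁿ b aⁿ` travels to coordinate `n`, acts there by the `n`-th generator and
returns, so this block carries the given pair of representations. -/

noncomputable section

/-! ## The maximal and the minimal tensor norm -/

section TensorNorms

/-- A `*`-homomorphism between `C*`-algebras is continuous. -/
theorem StarAlgHom.continuous_of_cstarAlgebra {A B : Type*} [CStarAlgebra A] [CStarAlgebra B]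
    (f : A →⋆ₐ[ℂ] B) : Continuous f :=
  AddMonoidHomClass.continuous_of_bound f 1 fun x => by
    rw [one_mul]
    exact NonUnitalStarAlgHom.norm_apply_le f x

variable {A B : Type u} [CStarAlgebra A] [CStarAlgebra B]

/-- The canonical map `A ⊗_max B → A ⊗_min B` is bijective if and only if the maximal and the
minimal norm agree on the algebraic tensor product. -/
theorem maxTensorEqMinTensor_iff : MaxTensorEqMinTensor A B ↔
    ∀ x : A ⊗[ℂ] B, maxTensorSeminorm A B x = minTensorSeminorm A B x := by
  refine ⟨fun h x => ?_, fun h => ?_⟩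
  -- An injective `*`-homomorphism between C*-algebras is isometric.
  · have h1 := NonUnitalStarAlgHom.norm_map (maxToMin A B) h.1 ((maxTensorSeminorm A B).of x)
    rw [maxToMin_of, CStarSeminorm.norm_of, CStarSeminorm.norm_of] at h1
    exact h1.symm
  · have hc : Continuous (maxToMin A B) := (maxToMin A B).continuous_of_cstarAlgebra
    have hi : Isometry (maxToMin A B) := by
      refine AddMonoidHomClass.isometry_of_norm _ fun z => ?_
      induction z using (maxTensorSeminorm A B).denseRange_of.induction_on with
      | hp => exact isClosed_eq hc.norm continuous_norm
      | ih x => rw [maxToMin_of, CStarSeminorm.norm_of, CStarSeminorm.norm_of, h]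
    refine ⟨hi.injective, fun z => ?_⟩
    -- The isometric image of a complete space is closed, and this one contains the dense image of
    -- the algebraic tensor product.
    have hcl : IsClosed (Set.range (maxToMin A B)) := hi.isClosedEmbedding.isClosed_range
    induction z using (minTensorSeminorm A B).denseRange_of.induction_on with
    | hp => exact hcl
    | ih x => exact ⟨_, maxToMin_of A B x⟩

variable {A' B' : Type u} [CStarAlgebra A'] [CStarAlgebra B']

/-- The minimal tensor norm does not increase under tensor products of `*`-homomorphisms. -/
theorem minTensorSeminorm_map_le (f : A →⋆ₐ[ℂ] A') (g : B →⋆ₐ[ℂ] B') (x : A ⊗[ℂ] B) :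
    minTensorSeminorm A' B' (Algebra.TensorProduct.map f.toAlgHom g.toAlgHom x) ≤
      minTensorSeminorm A B x := by
  refine Real.iSup_le (fun πσ => ?_) ((minTensorSeminorm A B).nonneg x)
  -- Representations of `A'` and `B'` pull back along `f` and `g`, so the left supremum runs over
  -- part of the family on the right.
  let π : StarRep A := { Space := πσ.1.Space, hom := πσ.1.hom.comp f }
  let σ : StarRep B := { Space := πσ.2.Space, hom := πσ.2.hom.comp g }
  have h : ∀ y : A ⊗[ℂ] B, (πσ.1.tensor πσ.2).hom
      (Algebra.TensorProduct.map f.toAlgHom g.toAlgHom y) = (π.tensor σ).hom y := fun y => by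
    induction y using TensorProduct.induction_on with
    | zero => rw [map_zero, map_zero]; exact (map_zero (π.tensor σ).hom).symm
    | add y z hy hz => rw [map_add, map_add, hy, hz]; exact (map_add (π.tensor σ).hom _ _).symm
    | tmul a b => rfl
  rw [h]
  exact le_ciSup (f := fun πσ : StarRep A × StarRep B => ‖(πσ.1.tensor πσ.2).hom x‖)
    ((StarRep.bddAbove_tensor x).mono (by rintro _ ⟨πσ, rfl⟩; exact ⟨πσ.1.tensor πσ.2, rfl⟩))
    (π, σ)

/-- The representation of `A ⊗ B` given by two commuting representations of `A` and `B` on the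
same Hilbert space. -/
def StarRep.ofCommute {H : Type u} [NormedAddCommGroup H] [InnerProductSpace ℂ H] [CompleteSpace H]
    (f : A →⋆ₐ[ℂ] (H →L[ℂ] H)) (g : B →⋆ₐ[ℂ] (H →L[ℂ] H)) (hfg : ∀ a b, Commute (f a) (g b)) :
    StarRep (A ⊗[ℂ] B) where
  Space := H
  hom :=
    { Algebra.TensorProduct.lift f.toAlgHom g.toAlgHom hfg with
      map_star' := fun x => by
        change Algebra.TensorProduct.lift f.toAlgHom g.toAlgHom hfg (star x) =
          star (Algebra.TensorProduct.lift f.toAlgHom g.toAlgHom hfg x)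
        induction x using TensorProduct.induction_on with
        | zero => simp
        | add x y hx hy => rw [star_add, map_add, hx, hy, map_add, star_add]
        | tmul a b =>
          rw [TensorProduct.star_tmul, Algebra.TensorProduct.lift_tmul,
            Algebra.TensorProduct.lift_tmul]
          change f (star a) * g (star b) = star (f a * g b)
          -- The involution reverses the two factors; commutation at `star a`, `star b` restores
          -- their order.
          rw [star_mul, map_star, map_star, ← map_star g, ← map_star f, (hfg _ _).eq] }

/-- The restriction of a representation of `A ⊗ B` to `A`. -/
def StarRep.restrictLeft (π : StarRep (A ⊗[ℂ] B)) : A →⋆ₐ[ℂ] (π.Space →L[ℂ] π.Space) :=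
  { π.hom.toAlgHom.comp Algebra.TensorProduct.includeLeft with
    map_star' := fun a => by
      change π.hom (star a ⊗ₜ[ℂ] 1) = star (π.hom (a ⊗ₜ[ℂ] 1))
      rw [← map_star, TensorProduct.star_tmul, star_one] }

/-- The restriction of a representation of `A ⊗ B` to `B`. -/
def StarRep.restrictRight (π : StarRep (A ⊗[ℂ] B)) : B →⋆ₐ[ℂ] (π.Space →L[ℂ] π.Space) :=
  { π.hom.toAlgHom.comp Algebra.TensorProduct.includeRight with
    map_star' := fun b => by
      change π.hom (1 ⊗ₜ[ℂ] star b) = star (π.hom (1 ⊗ₜ[ℂ] b))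
      rw [← map_star, TensorProduct.star_tmul, star_one] }

theorem StarRep.restrictLeft_apply (π : StarRep (A ⊗[ℂ] B)) (a : A) :
    π.restrictLeft a = π.hom (a ⊗ₜ 1) := rfl

theorem StarRep.restrictRight_apply (π : StarRep (A ⊗[ℂ] B)) (b : B) :
    π.restrictRight b = π.hom (1 ⊗ₜ b) := rfl

theorem StarRep.commute_restrict (π : StarRep (A ⊗[ℂ] B)) (a : A) (b : B) :
    Commute (π.restrictLeft a) (π.restrictRight b) := by
  rw [commute_iff_eq, restrictLeft_apply, restrictRight_apply, ← map_mul, ← map_mul,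
    Algebra.TensorProduct.tmul_mul_tmul, Algebra.TensorProduct.tmul_mul_tmul]
  simp only [mul_one, one_mul]

theorem StarRep.hom_tmul (π : StarRep (A ⊗[ℂ] B)) (a : A) (b : B) :
    π.hom (a ⊗ₜ b) = π.restrictLeft a * π.restrictRight b := by
  rw [restrictLeft_apply, restrictRight_apply, ← map_mul, Algebra.TensorProduct.tmul_mul_tmul,
    mul_one, one_mul]

/-- Every pair of commuting representations of `A` and `B` is contained in the restriction along
`f` and `g` of a pair of commuting representations of `A'` and `B'`. -/
def CommutingRepsExtend (f : A →⋆ₐ[ℂ] A') (g : B →⋆ₐ[ℂ] B') : Prop :=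
  ∀ (K : Type u) [NormedAddCommGroup K] [InnerProductSpace ℂ K] [CompleteSpace K]
    (π : A →⋆ₐ[ℂ] (K →L[ℂ] K)) (σ : B →⋆ₐ[ℂ] (K →L[ℂ] K)), (∀ a b, Commute (π a) (σ b)) →
    ∃ (L : Type u) (_ : NormedAddCommGroup L) (_ : InnerProductSpace ℂ L) (_ : CompleteSpace L)
      (π' : A' →⋆ₐ[ℂ] (L →L[ℂ] L)) (σ' : B' →⋆ₐ[ℂ] (L →L[ℂ] L)) (J : K →ₗᵢ[ℂ] L),
      (∀ a b, Commute (π' a) (σ' b)) ∧ (∀ a v, π' (f a) (J v) = J (π a v)) ∧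
      ∀ b v, σ' (g b) (J v) = J (σ b v)

/-- If commuting representations of `A` and `B` extend along `f` and `g`, then `f ⊗ g` does not decrease the maximal norm. -/
theorem maxTensorSeminorm_le_map (f : A →⋆ₐ[ℂ] A') (g : B →⋆ₐ[ℂ] B')
    (h : CommutingRepsExtend f g) (x : A ⊗[ℂ] B) :
    maxTensorSeminorm A B x ≤
      maxTensorSeminorm A' B' (Algebra.TensorProduct.map f.toAlgHom g.toAlgHom x) := by
  refine Real.iSup_le (fun π => ?_) ((maxTensorSeminorm A' B').nonneg _)
  obtain ⟨L, _, _, _, π', σ', J, hc, hf, hg⟩ :=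
    h π.Space π.restrictLeft π.restrictRight π.commute_restrict
  let Θ := StarRep.ofCommute π' σ' hc
  have key : ∀ (y : A ⊗[ℂ] B) (v : π.Space),
      Θ.hom (Algebra.TensorProduct.map f.toAlgHom g.toAlgHom y) (J v) = J (π.hom y v) := by
    intro y v
    induction y using TensorProduct.induction_on with
    | zero => rw [map_zero, map_zero, map_zero]; exact (map_zero J).symm
    | add y z hy hz =>
      rw [map_add, map_add, map_add, add_apply, map_add, ← hy, ← hz]
      rfl
    | tmul a b =>
      rw [π.hom_tmul, mul_apply_eq_comp, ← hf, ← hg]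
      rfl
  refine le_trans ?_ (le_ciSup (StarRep.bddAbove_tensor _) Θ)
  -- As `J` is isometric and intertwines, `π.hom x` is a restriction of the image of `x` under `Θ`
  -- to the range of `J`, so its norm cannot be larger.
  refine ContinuousLinearMap.opNorm_le_bound _ (norm_nonneg _) fun v => ?_
  rw [← J.norm_map, ← key, ← J.norm_map v]
  exact ContinuousLinearMap.le_opNorm _ _

/-- If commuting representations of `A` and `B` extend along `f` and `g`, then equality of the maximal and the minimal tensor product passes from
`A'` and `B'` to `A` and `B`. -/
theorem MaxTensorEqMinTensor.of_map (f : A →⋆ₐ[ℂ] A') (g : B →⋆ₐ[ℂ] B')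
    (h : CommutingRepsExtend f g)
    (h' : MaxTensorEqMinTensor A' B') : MaxTensorEqMinTensor A B := by
  rw [maxTensorEqMinTensor_iff] at h' ⊢
  refine fun x => le_antisymm ?_ (minTensorSeminorm_le A B x)
  refine (maxTensorSeminorm_le_map f g h x).trans ?_
  rw [h']
  exact minTensorSeminorm_map_le f g x

end TensorNorms

/-! ## Full group `C*`-algebras -/

namespace FullGroupCStar

variable {G H : Type u} [Group G] [Group H]

variable (G) in
/-- The canonical map of `G` to the unitary group of `C*(G)`. -/
def canonical : G →* unitary (FullGroupCStar G) where
  toFun g := ⟨(fullGroupSeminorm G).of (MonoidAlgebra.single g 1), by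
    rw [Unitary.mem_iff, ← map_star, ← map_mul, ← map_mul, MonoidAlgebra.star_single_complex,
      MonoidAlgebra.single_mul_single, MonoidAlgebra.single_mul_single]
    simp [← MonoidAlgebra.one_def]⟩
  map_one' := Subtype.ext (map_one (fullGroupSeminorm G).of)
  map_mul' g h := Subtype.ext <| by
    change (fullGroupSeminorm G).of _ = (fullGroupSeminorm G).of _ * (fullGroupSeminorm G).of _
    rw [← map_mul, MonoidAlgebra.single_mul_single, mul_one]

theorem coe_canonical (g : G) : (canonical G g : FullGroupCStar G) =
    (fullGroupSeminorm G).of (MonoidAlgebra.single g 1) := rfl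

/-- The linear span of the canonical unitaries is dense in `C*(G)`. -/
theorem induction_on {P : FullGroupCStar G → Prop} (x : FullGroupCStar G)
    (isClosed : IsClosed {x | P x}) (add : ∀ x y, P x → P y → P (x + y))
    (smul : ∀ (c : ℂ) x, P x → P (c • x)) (canonical : ∀ g, P (canonical G g)) : P x := by
  induction x using (fullGroupSeminorm G).denseRange_of.induction_on with
  | hp => exact isClosed
  | ih x =>
    induction x using MonoidAlgebra.induction_linear with
    | zero => simpa using smul 0 _ (canonical 1)
    | add x y hx hy => rw [map_add]; exact add _ _ hx hy
    | single g a =>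
      have h := smul a _ (canonical g)
      rwa [coe_canonical, ← map_smul, MonoidAlgebra.smul_single, smul_eq_mul, mul_one] at h

/-- The extension of a unitary representation of `G` to `C*(G)`. -/
def extend {K : Type u} [NormedAddCommGroup K] [InnerProductSpace ℂ K] [CompleteSpace K]
    (ρ : G →* unitary (K →L[ℂ] K)) : FullGroupCStar G →⋆ₐ[ℂ] (K →L[ℂ] K) :=
  CStarSeminorm.lift (UnitaryRep.toStarRep ⟨K, ρ⟩).hom fun x =>
    le_ciSup (UnitaryRep.bddAbove x) (⟨K, ρ⟩ : UnitaryRep G)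

theorem extend_canonical {K : Type u} [NormedAddCommGroup K] [InnerProductSpace ℂ K]
    [CompleteSpace K] (ρ : G →* unitary (K →L[ℂ] K)) (g : G) :
    extend ρ (canonical G g) = ρ g := by
  rw [coe_canonical]
  exact ((CStarSeminorm.lift_of _ _ _).trans (UnitaryRep.toStarRep_single _ _ _)).trans
    (one_smul ℂ _)

/-- Extensions of commuting unitary representations commute. -/
theorem commute_extend {K : Type u} [NormedAddCommGroup K] [InnerProductSpace ℂ K]
    [CompleteSpace K] (ρ : G →* unitary (K →L[ℂ] K)) (τ : H →* unitary (K →L[ℂ] K))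
    (h : ∀ g k, Commute (ρ g) (τ k)) (a : FullGroupCStar G) (b : FullGroupCStar H) :
    Commute (extend ρ a) (extend τ b) := by
  have hρ : Continuous (extend ρ) := (extend ρ).continuous_of_cstarAlgebra
  have hτ : Continuous (extend τ) := (extend τ).continuous_of_cstarAlgebra
  induction a using induction_on with
  | isClosed => exact isClosed_eq (hρ.mul continuous_const) (continuous_const.mul hρ)
  | add x y hx hy => rw [map_add]; exact hx.add_left hy
  | smul c x hx => rw [map_smul]; exact hx.smul_left c
  | canonical g =>
    induction b using induction_on with
    | isClosed => exact isClosed_eq (continuous_const.mul hτ) (hτ.mul continuous_const)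
    | add x y hx hy => rw [map_add]; exact hx.add_right hy
    | smul c x hx => rw [map_smul]; exact hx.smul_right c
    | canonical k =>
      rw [extend_canonical, extend_canonical]
      exact congrArg Subtype.val (h g k)

/-- The `*`-homomorphism `ℂ[G] → ℂ[H]` induced by a group homomorphism `G → H`. -/
def mapGroupAlgebra (φ : G →* H) : MonoidAlgebra ℂ G →⋆ₐ[ℂ] MonoidAlgebra ℂ H :=
  { MonoidAlgebra.mapDomainAlgHom ℂ ℂ φ with
    map_star' := fun x => by
      change MonoidAlgebra.mapDomainAlgHom ℂ ℂ φ (star x) =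
        star (MonoidAlgebra.mapDomainAlgHom ℂ ℂ φ x)
      induction x using MonoidAlgebra.induction_linear with
      | zero => simp
      | add x y hx hy => rw [star_add, map_add, hx, hy, map_add, star_add]
      | single g a => simp [MonoidAlgebra.star_single_complex] }

theorem mapGroupAlgebra_single (φ : G →* H) (g : G) (a : ℂ) :
    mapGroupAlgebra φ (MonoidAlgebra.single g a) = MonoidAlgebra.single (φ g) a :=
  MonoidAlgebra.mapDomain_single

/-- Every unitary representation of `H` becomes one of `G` by composition with `φ`, so the norm of
`C*(H)` is a supremum over part of the family defining that of `C*(G)`. This is the bound needed to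
define `map`. -/
theorem norm_of_mapGroupAlgebra_le (φ : G →* H) (x : MonoidAlgebra ℂ G) :
    ‖((fullGroupSeminorm H).of.comp (mapGroupAlgebra φ)) x‖ ≤ fullGroupSeminorm G x := by
  rw [StarAlgHom.comp_apply, CStarSeminorm.norm_of]
  refine Real.iSup_le (fun ρ => ?_) ((fullGroupSeminorm G).nonneg x)
  let ρ' : UnitaryRep G := { Space := ρ.Space, hom := ρ.hom.comp φ }
  have h : ∀ y, ρ.toStarRep.hom (mapGroupAlgebra φ y) = ρ'.toStarRep.hom y := fun y => by
    induction y using MonoidAlgebra.induction_linear with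
    | zero => rw [map_zero, map_zero]; exact (map_zero ρ'.toStarRep.hom).symm
    | add x y hx hy => rw [map_add, map_add, hx, hy]; exact (map_add ρ'.toStarRep.hom _ _).symm
    | single g a =>
      rw [mapGroupAlgebra_single]
      exact (ρ.toStarRep_single _ _).trans (ρ'.toStarRep_single _ _).symm
  rw [h]
  exact le_ciSup (UnitaryRep.bddAbove x) ρ'

/-- The `*`-homomorphism `C*(G) → C*(H)` induced by a group homomorphism `G → H`. -/
def map (φ : G →* H) : FullGroupCStar G →⋆ₐ[ℂ] FullGroupCStar H :=
  CStarSeminorm.lift ((fullGroupSeminorm H).of.comp (mapGroupAlgebra φ))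
    (norm_of_mapGroupAlgebra_le φ)

theorem map_canonical (φ : G →* H) (g : G) : map φ (canonical G g) = canonical H (φ g) := by
  rw [coe_canonical, coe_canonical, ← mapGroupAlgebra_single]
  exact CStarSeminorm.lift_of _ _ _

/-- An isometry that intertwines a representation of `C*(G)` with the restriction of a
representation of `C*(H)` on the canonical unitaries does so on `C*(G)`. -/
theorem intertwine {K L : Type u} [NormedAddCommGroup K] [InnerProductSpace ℂ K] [CompleteSpace K]
    [NormedAddCommGroup L] [InnerProductSpace ℂ L] [CompleteSpace L] (φ : G →* H)
    (f : FullGroupCStar G →⋆ₐ[ℂ] (K →L[ℂ] K)) (ρ : H →* unitary (L →L[ℂ] L)) (J : K →ₗᵢ[ℂ] L)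
    (h : ∀ g v, (ρ (φ g) : L →L[ℂ] L) (J v) = J (f (canonical G g) v))
    (a : FullGroupCStar G) (v : K) : extend ρ (map φ a) (J v) = J (f a v) := by
  have hρ : Continuous (extend ρ) := (extend ρ).continuous_of_cstarAlgebra
  have hφ : Continuous (map φ) := (map φ).continuous_of_cstarAlgebra
  have hf : Continuous f := (f).continuous_of_cstarAlgebra
  induction a using induction_on with
  | isClosed =>
    exact isClosed_eq ((hρ.comp hφ).clm_apply continuous_const)
      (J.continuous.comp (hf.clm_apply continuous_const))
  | add x y hx hy => simp only [map_add, add_apply, hx, hy]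
  | smul c x hx => simp only [map_smul, smul_apply, hx]
  | canonical g => rw [map_canonical, extend_canonical]; exact h g v

end FullGroupCStar

/-! ## Monomial operators on `ℓ²(I, K)` -/

namespace lp

variable {I K : Type*} [NormedAddCommGroup K] [InnerProductSpace ℂ K]

/-- The isometry `(T f) i = w_i (f (e⁻¹ i))` of `ℓ²(I, K)`. -/
def monomialIsometry (e : Equiv.Perm I) (w : I → K ≃ₗᵢ[ℂ] K) :
    lp (fun _ : I => K) 2 →ₗᵢ[ℂ] lp (fun _ : I => K) 2 where
  toFun f := ⟨fun i => w i (f (e.symm i)), by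
    have h := (e.symm.summable_iff (f := fun i => ‖f i‖ ^ (2 : ENNReal).toReal)).2
      ((lp.memℓp f).summable (by norm_num))
    refine memℓp_gen ?_
    simpa only [LinearIsometryEquiv.norm_map, Function.comp_def] using h⟩
  map_add' f g := by ext i; exact map_add (w i) _ _
  map_smul' c f := by ext i; simp
  norm_map' f := by
    have h2 : (0 : ℝ) < (2 : ENNReal).toReal := by norm_num
    refine (Real.rpow_left_inj (norm_nonneg _) (norm_nonneg _) h2.ne').1 ?_
    rw [lp.norm_rpow_eq_tsum h2, lp.norm_rpow_eq_tsum h2,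
      ← e.symm.tsum_eq fun i => ‖f i‖ ^ (2 : ENNReal).toReal]
    exact tsum_congr fun i => by simp

/-- The unitary operator `(T f) i = w_i (f (e⁻¹ i))` on `ℓ²(I, K)`. -/
def monomial (e : Equiv.Perm I) (w : I → K ≃ₗᵢ[ℂ] K) :
    lp (fun _ : I => K) 2 ≃ₗᵢ[ℂ] lp (fun _ : I => K) 2 where
  __ := monomialIsometry e w
  -- Solving `g i = w_i (f (e⁻¹ i))` for `f j` puts `i = e j`, hence the weight at `e j` is the one
  -- to invert.
  invFun := monomialIsometry e.symm fun i => (w (e i)).symm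
  left_inv f := by ext i; simp [monomialIsometry]
  right_inv f := by ext i; simp [monomialIsometry]
  norm_map' := (monomialIsometry e w).norm_map

theorem monomial_apply (e : Equiv.Perm I) (w : I → K ≃ₗᵢ[ℂ] K) (f : lp (fun _ : I => K) 2)
    (i : I) : monomial e w f i = w i (f (e.symm i)) := rfl

theorem monomial_single [DecidableEq I] (e : Equiv.Perm I) (w : I → K ≃ₗᵢ[ℂ] K) (i : I) (v : K) :
    monomial e w (lp.single 2 i v) = lp.single 2 (e i) (w (e i) v) := by
  ext j
  rw [monomial_apply, lp.single_apply, lp.single_apply]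
  rcases eq_or_ne j (e i) with rfl | hj
  · simp
  · rw [Pi.single_eq_of_ne hj, Pi.single_eq_of_ne (by rwa [Ne, Equiv.symm_apply_eq]), map_zero]

/-- The embedding of `K` as the `i`-th coordinate of `ℓ²(I, K)`. -/
def singleIsometry [DecidableEq I] (i : I) : K →ₗᵢ[ℂ] lp (fun _ : I => K) 2 where
  toFun v := lp.single 2 i v
  map_add' v v' := lp.single_add (E := fun _ : I => K) 2 i v v'
  map_smul' c v := lp.single_smul (E := fun _ : I => K) 2 i c v
  norm_map' v := by
    have h : (0 : ENNReal) < 2 := by norm_num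
    exact lp.norm_single (E := fun _ : I => K) h i v

theorem monomial_mul (e e' : Equiv.Perm I) (w w' : I → K ≃ₗᵢ[ℂ] K) :
    monomial e w * monomial e' w' = monomial (e * e') fun i => w i * w' (e.symm i) := by
  ext f i
  rfl

/-- Both products are monomial over the same permutation, so only their weights remain to be
compared; `hw` is that comparison. -/
theorem commute_monomial {e e' : Equiv.Perm I} {w w' : I → K ≃ₗᵢ[ℂ] K} (he : Commute e e')
    (hw : ∀ i, w i * w' (e.symm i) = w' i * w (e'.symm i)) :
    Commute (monomial e w) (monomial e' w') := by
  rw [commute_iff_eq, monomial_mul, monomial_mul, he.eq, funext hw]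

end lp

/-! ## The free group on countably many generators inside the free group on two generators -/

/-- The homomorphism `F_∞ → F_2` that maps the `n`-th generator to `a⁻ⁿ b aⁿ`. -/
def FreeGroup.toFinTwo : FreeGroup ℕ →* FreeGroup (Fin 2) :=
  lift fun n => (of 0 ^ n)⁻¹ * of 1 * of 0 ^ n

/-- Homomorphisms of free groups commute if they commute on generators. -/
theorem FreeGroup.commute_lift {α β M : Type*} [Group M] {f : α → M} {g : β → M}
    (h : ∀ i j, Commute (f i) (g j)) (x : FreeGroup α) (y : FreeGroup β) :
    Commute (lift f x) (lift g y) := by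
  induction x using FreeGroup.induction_on with
  | C1 => rw [_root_.map_one]; exact Commute.one_left _
  | of i =>
    rw [lift_apply_of]
    induction y using FreeGroup.induction_on with
    | C1 => rw [_root_.map_one]; exact Commute.one_right _
    | of j => rw [lift_apply_of]; exact h i j
    | inv_of j hj => rw [_root_.map_inv]; exact hj.inv_right
    | mul x y hx hy => rw [_root_.map_mul]; exact hx.mul_right hy
  | inv_of i hi => rw [_root_.map_inv]; exact hi.inv_left
  | mul x y hx hy => rw [_root_.map_mul]; exact hx.mul_left hy

/-! ### Monomial representations of `F_2` -/

section MonomialRep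

variable {I K : Type*} [NormedAddCommGroup K] [InnerProductSpace ℂ K]

/-- The representation of `F_2` on `ℓ²(I, K)` in which `a` permutes the coordinates and `b` is
diagonal. -/
def FreeGroup.monomialRep (e : Equiv.Perm I) (w : I → K ≃ₗᵢ[ℂ] K) :
    FreeGroup (Fin 2) →* (lp (fun _ : I => K) 2 ≃ₗᵢ[ℂ] lp (fun _ : I => K) 2) :=
  lift ![lp.monomial e 1, lp.monomial 1 w]

/-- Only the four pairs of generators matter. A permutation commutes with a diagonal operator whose
weights are constant along its orbits, which is what `h` and `h'` supply for the two mixed pairs. -/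
theorem FreeGroup.commute_monomialRep {e e' : Equiv.Perm I} {w w' : I → K ≃ₗᵢ[ℂ] K}
    (he : Commute e e') (hw : ∀ i, Commute (w i) (w' i)) (h : ∀ i, w' (e.symm i) = w' i)
    (h' : ∀ i, w (e'.symm i) = w i) (x y : FreeGroup (Fin 2)) :
    Commute (monomialRep e w x) (monomialRep e' w' y) := by
  refine commute_lift (fun i j => ?_) x y
  fin_cases i <;> fin_cases j
  · exact lp.commute_monomial he fun i => rfl
  · exact lp.commute_monomial (Commute.one_right e) fun i => by simp [h]
  · exact lp.commute_monomial (Commute.one_left e') fun i => by simp [h']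
  · exact lp.commute_monomial (Commute.refl 1) fun i => (hw i).eq

/-- The restriction of `monomialRep` to `F_∞` contains every representation `u` of `F_∞` whose
generators are the diagonal entries of `b` along an orbit of `a`. -/
theorem FreeGroup.monomialRep_toFinTwo_single [DecidableEq I] (e : Equiv.Perm I)
    (w : I → K ≃ₗᵢ[ℂ] K) (u : FreeGroup ℕ →* (K ≃ₗᵢ[ℂ] K)) (i : I)
    (hu : ∀ n, w ((e ^ n) i) = u (of n)) (x : FreeGroup ℕ)
    (v : K) :
    monomialRep e w (toFinTwo x) (lp.single 2 i v) = lp.single 2 i (u x v) := by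
  induction x using FreeGroup.induction_on generalizing v with
  | C1 => simp
  | of n =>
    have ha : ∀ (n : ℕ) (v : K), (monomialRep e w (of 0) ^ n) (lp.single 2 i v) =
        lp.single 2 ((e ^ n) i) v := by
      intro n
      induction n with
      | zero => intro v; simp
      | succ n ih =>
        intro v
        rw [pow_succ', LinearIsometryEquiv.coe_mul, Function.comp_apply, ih, monomialRep,
          lift_apply_of]
        refine (lp.monomial_single _ _ _ _).trans ?_
        rw [pow_succ']
        rfl
    have hb : monomialRep e w (of 1) (lp.single 2 ((e ^ n) i) v) =
        lp.single 2 ((e ^ n) i) (u (of n) v) := by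
      rw [monomialRep, lift_apply_of, ← hu]
      exact lp.monomial_single _ _ _ _
    -- Read from right to left: `aⁿ` carries the block `i` to `eⁿ i`, `b` acts there by `u (of n)`,
    -- and `a⁻ⁿ` carries the result back.
    rw [toFinTwo, lift_apply_of, _root_.map_mul, _root_.map_mul, _root_.map_inv,
      _root_.map_pow, LinearIsometryEquiv.coe_mul, Function.comp_apply,
      LinearIsometryEquiv.coe_mul, Function.comp_apply, ha, hb, ← ha]
    exact LinearIsometryEquiv.symm_apply_apply _ _
  | inv_of n h =>
    -- The case of the inverse follows by inverting the identity for the generator, taken at the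
    -- preimage of `v`; this is why `v` is generalized.
    have h1 := h ((u (of n))⁻¹ v)
    rw [show u (of n) ((u (of n))⁻¹ v) = v from
      LinearIsometryEquiv.apply_symm_apply _ _] at h1
    rw [_root_.map_inv, _root_.map_inv, _root_.map_inv]
    exact (LinearIsometryEquiv.symm_apply_eq _).2 h1.symm
  | mul x y hx hy => simp only [_root_.map_mul, LinearIsometryEquiv.coe_mul, Function.comp_apply, hx,
    hy]

end MonomialRep

/-- The isometries of `K` given by a representation of `C*(G)` on `K`. -/
def FullGroupCStar.isometryRep {G K : Type u} [Group G] [NormedAddCommGroup K]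
    [InnerProductSpace ℂ K] [CompleteSpace K] (f : FullGroupCStar G →⋆ₐ[ℂ] (K →L[ℂ] K)) :
    G →* (K ≃ₗᵢ[ℂ] K) :=
  Unitary.linearIsometryEquiv.toMonoidHom.comp
    ((Unitary.map ⟨(f : FullGroupCStar G →* (K →L[ℂ] K)), map_star f⟩).toMonoidHom.comp
      (canonical G))

/-- The unitary representation of `F_2` on `ℓ²(I, K)` in which `a` permutes the coordinates and
`b` is diagonal. -/
def FullGroupCStar.monomialUnitaryRep {I K : Type*} [NormedAddCommGroup K] [InnerProductSpace ℂ K]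
    [CompleteSpace K] (e : Equiv.Perm I) (w : I → K ≃ₗᵢ[ℂ] K) : FreeGroup (Fin 2) →*
      unitary (lp (fun _ : I => K) 2 →L[ℂ] lp (fun _ : I => K) 2) :=
  Unitary.linearIsometryEquiv.symm.toMonoidHom.comp (FreeGroup.monomialRep e w)

theorem FullGroupCStar.extend_map_toFinTwo_single {I K : Type} [DecidableEq I]
    [NormedAddCommGroup K] [InnerProductSpace ℂ K] [CompleteSpace K] (e : Equiv.Perm I)
    (w : I → K ≃ₗᵢ[ℂ] K) (π : FullGroupCStar (FreeGroup ℕ) →⋆ₐ[ℂ] (K →L[ℂ] K)) (i : I)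
    (hw : ∀ n, w ((e ^ n) i) = isometryRep π (FreeGroup.of n))
    (a : FullGroupCStar (FreeGroup ℕ)) (v : K) :
    extend (monomialUnitaryRep e w) (map FreeGroup.toFinTwo a) (lp.singleIsometry i v) =
      lp.singleIsometry i (π a v) :=
  intertwine FreeGroup.toFinTwo π (monomialUnitaryRep e w) (lp.singleIsometry i)
    (FreeGroup.monomialRep_toFinTwo_single e w (isometryRep π) i hw) a v

/-- Commuting representations of two copies of `C*(F_∞)` extend to `C*(F_2)`. -/
theorem FullGroupCStar.commutingRepsExtend_toFinTwo :
    CommutingRepsExtend (map FreeGroup.toFinTwo) (map FreeGroup.toFinTwo) := by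
  intro K _ _ _ π σ hπσ
  let u := isometryRep π
  let u' := isometryRep σ
  -- One axis for each copy of `F_2`. The axes are `ℤ` and not `ℕ` so that the shifts are
  -- invertible.
  let e : Equiv.Perm (ℤ × ℤ) := Equiv.prodCongr (Equiv.addRight 1) (Equiv.refl ℤ)
  let e' : Equiv.Perm (ℤ × ℤ) := Equiv.prodCongr (Equiv.refl ℤ) (Equiv.addRight 1)
  -- `toNat` places generator `0` on negative coordinates. This choice is harmless, as only the
  -- forward orbit of the origin is compared with `u`.
  let w : ℤ × ℤ → K ≃ₗᵢ[ℂ] K := fun i => u (FreeGroup.of i.1.toNat)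
  let w' : ℤ × ℤ → K ≃ₗᵢ[ℂ] K := fun i => u' (FreeGroup.of i.2.toNat)
  have he : ∀ n : ℕ, (e ^ n) 0 = ((n : ℤ), (0 : ℤ)) := fun n => by
    induction n with
    | zero => rfl
    | succ n ih => rw [pow_succ', Equiv.Perm.mul_apply, ih]; simp [e]
  have he' : ∀ n : ℕ, (e' ^ n) 0 = ((0 : ℤ), (n : ℤ)) := fun n => by
    induction n with
    | zero => rfl
    | succ n ih => rw [pow_succ', Equiv.Perm.mul_apply, ih]; simp [e']
  -- Here the commutation of `π` and `σ` enters, at canonical unitaries.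
  have hw : ∀ i, Commute (w i) (w' i) := fun i => by
    ext v
    exact DFunLike.congr_fun (hπσ (canonical _ (FreeGroup.of i.1.toNat))
      (canonical _ (FreeGroup.of i.2.toNat))).eq v
  have hc : ∀ x y, Commute (FreeGroup.monomialRep e w x) (FreeGroup.monomialRep e' w' y) :=
    -- The shifts act on different axes, and each weight ignores the axis shifted by the other copy.
    FreeGroup.commute_monomialRep (by ext i <;> rfl) hw (fun i => rfl) (fun i => rfl)
  exact ⟨lp (fun _ : ℤ × ℤ => K) 2, _, _, inferInstance, extend (monomialUnitaryRep e w),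
    extend (monomialUnitaryRep e' w'), lp.singleIsometry 0,
    commute_extend _ _ fun g k => (hc g k).map Unitary.linearIsometryEquiv.symm,
    extend_map_toFinTwo_single e w π 0 fun n => by rw [he]; rfl,
    extend_map_toFinTwo_single e' w' σ 0 fun n => by rw [he']; rfl⟩

end

theorem mainTheorem9
    (hF : MaxTensorEqMinTensor (FullGroupCStar (FreeGroup (Fin 2)))
      (FullGroupCStar (FreeGroup (Fin 2)))) :
    MaxTensorEqMinTensor (FullGroupCStar (FreeGroup ℕ)) (FullGroupCStar (FreeGroup ℕ)) :=
  hF.of_map (FullGroupCStar.map FreeGroup.toFinTwo) (FullGroupCStar.map FreeGroup.toFinTwo)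
    FullGroupCStar.commutingRepsExtend_toFinTwo
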